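/- Let $a<b$ be real numbers and let $\mu$ be a Borel probability measure on $\mathbb{R}$ with $\operatorname{Supp}(\mu)\subset[a,b]$ and $\{a,b\}\subset\operatorname{Supp}(\mu)$. Let $$C(w)=\int_a^b\frac{\mu[dx]}{w-x}\qquad(w\in\mathbb{C}\setminus\operatorname{Supp}(\mu))$$ be its Cauchy transform, and for $(\chi,\eta)\in[a,b]\times[0,1]$ let $$f_{(\chi,\eta)}(w)=\int_a^b\log(w-x)\,\mu[dx]-(1-\eta)\log(w-\chi)\qquad(w\in\mathbb{C}\setminus\mathbb{R}),$$ with the principal branch of the logarithm, so that $f'_{(\chi,\eta)}(w)=C(w)-\frac{1-\eta}{w-\chi}$. Let $\mathbb{H}=\{w\in\mathbb{C}:\operatorname{Im}w>0\}$. The liquid region $\mathcal{L}$ is the set of all $(\chi,\eta)\in[a,b]\times[0,1]$ for which $f'_{(\chi,\eta)}$ has a root in $\mathbb{H}$. Then $\mathcal{L}\subset(a,b)\times(0,1)$, and for every $(\chi,\eta)\in\mathcal{L}$ the function $f'_{(\chi,\eta)}$ has exactly one root in $\mathbb{H}$, and this root has multiplicity $1$. Let $W_{\mathcal{L}}:\mathcal{L}\to\mathbb{H}$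 map $(\chi,\eta)$ to this root. Then $W_{\mathcal{L}}$ is a homeomorphism of $\mathcal{L}$ (with the topology induced from $\mathbb{R}^2$) onto $\mathbb{H}$, with inverse $w\mapsto(\chi_{\mathcal{L}}(w),\eta_{\mathcal{L}}(w))$ given by $$\chi_{\mathcal{L}}(w)=w+\frac{C(\bar w)(w-\bar w)}{C(w)-C(\bar w)},\qquad \eta_{\mathcal{L}}(w)=1+\frac{C(w)\,C(\bar w)\,(w-\bar w)}{C(w)-C(\bar w)}.$$ -/

import Mathlib

open MeasureTheory Complex UpperHalfPlane Set

/-- The Cauchy transform `C(w) = ∫ μ(dx) / (w - x)`, meaningful for `w` off the support of `μ`. -/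
noncomputable def cauchyTransform (μ : Measure ℝ) (w : ℂ) : ℂ :=
  ∫ x : ℝ, 1 / (w - (x : ℂ)) ∂μ

/-- The steepest descent function
`f_(χ,η)(w) = ∫ log (w - x) μ(dx) - (1 - η) log (w - χ)`, for non-real `w`,
with the principal branch of the logarithm. -/
noncomputable def steepestFun (μ : Measure ℝ) (p : ℝ × ℝ) (w : ℂ) : ℂ :=
  (∫ x : ℝ, Complex.log (w - (x : ℂ)) ∂μ) - (1 - (p.2 : ℂ)) * Complex.log (w - (p.1 : ℂ))

/-- Off the real line `f_(χ,η)` is differentiable, with derivative `C(w) - (1 - η) / (w - χ)`. -/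
theorem hasDerivAt_steepestFun (μ : Measure ℝ) [IsProbabilityMeasure μ] (a b : ℝ)
    (hsupp : μ.support ⊆ Icc a b) (p : ℝ × ℝ) (w : ℂ) (hw : w.im ≠ 0) :
    HasDerivAt (steepestFun μ p) (cauchyTransform μ w - (1 - (p.2 : ℂ)) / (w - (p.1 : ℂ))) w := by
  have hsl : ∀ (z : ℂ) (x : ℝ), z.im ≠ 0 → z - (x : ℂ) ∈ Complex.slitPlane := by
    intro z x hz
    rw [Complex.mem_slitPlane_iff]; right; simpa using hz
  have hae : ∀ᵐ x ∂μ, x ∈ Icc a b := by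
    filter_upwards [μ.support_mem_ae] with x hx using hsupp hx
  have hc : ∀ z : ℂ, z.im ≠ 0 → Continuous fun x : ℝ => Complex.log (z - (x : ℂ)) := by
    intro z hz
    exact Continuous.clog (by fun_prop) (fun x => hsl z x hz)
  have hd : 0 < |w.im| := abs_pos.mpr hw
  have hball : ∀ z ∈ Metric.ball w (|w.im| / 2), |w.im| / 2 ≤ |z.im| := by
    intro z hz
    have h1 : |(z - w).im| ≤ ‖z - w‖ := Complex.abs_im_le_norm _
    rw [Metric.mem_ball, dist_eq_norm] at hz
    have h2 := abs_sub_abs_le_abs_sub w.im z.im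
    rw [abs_sub_comm] at h2
    simp only [Complex.sub_im] at h1
    linarith
  have h1 := (hasDerivAt_integral_of_dominated_loc_of_deriv_le (μ := μ) (𝕜 := ℂ)
    (F := fun (z : ℂ) (x : ℝ) => Complex.log (z - (x : ℂ)))
    (F' := fun (z : ℂ) (x : ℝ) => 1 / (z - (x : ℂ))) (x₀ := w)
    (s := Metric.ball w (|w.im| / 2)) (bound := fun _ => 2 / |w.im|)
    (Metric.ball_mem_nhds _ (by positivity))
    (by
      filter_upwards [Metric.ball_mem_nhds w (half_pos hd)] with z hz
      have := hball z hz
      exact (hc z (abs_pos.mp (by linarith))).aestronglyMeasurable)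
    (by
      obtain ⟨M, hM⟩ := (isCompact_Icc (a := a) (b := b)).exists_bound_of_continuousOn
        (hc w hw).continuousOn
      refine Integrable.of_bound (hc w hw).aestronglyMeasurable M ?_
      filter_upwards [hae] with x hx using hM x hx)
    (by
      refine Continuous.aestronglyMeasurable ?_
      refine Continuous.div continuous_const (by fun_prop) ?_
      intro x
      exact Complex.slitPlane_ne_zero (hsl w x hw))
    (by
      refine Filter.Eventually.of_forall fun x z hz => ?_
      have h3 := hball z hz
      have h4 : |(z - (x : ℂ)).im| ≤ ‖z - (x : ℂ)‖ := Complex.abs_im_le_norm _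
      simp only [Complex.sub_im, Complex.ofReal_im, sub_zero] at h4
      rw [norm_div, norm_one, show 2 / |w.im| = 1 / (|w.im| / 2) by field_simp]
      exact one_div_le_one_div_of_le (by positivity) (by linarith))
    (integrable_const _)
    (by
      refine Filter.Eventually.of_forall fun x z hz => ?_
      have h3 := hball z hz
      exact ((hasDerivAt_id z).sub_const _).clog (hsl z x (abs_pos.mp (by linarith))))).2
  have h2 := (((hasDerivAt_id w).sub_const (p.1 : ℂ)).clog (hsl w p.1 hw)).const_mul (1 - (p.2 : ℂ))
  have h3 := h1.sub h2
  refine HasDerivAt.congr_deriv h3 ?_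
  simp only [cauchyTransform, id_eq, mul_one_div]

/-- The complex derivative `f'_(χ,η)`. -/
noncomputable def steepestDeriv (μ : Measure ℝ) (p : ℝ × ℝ) : ℂ → ℂ :=
  deriv (steepestFun μ p)

/-- The liquid region: the points `(χ, η)` of `[a, b] × [0, 1]` for which `f'_(χ,η)` has a root
in the upper half-plane. -/
def liquidRegion (μ : Measure ℝ) (a b : ℝ) : Set (ℝ × ℝ) :=
  {p | p ∈ Icc a b ×ˢ Icc (0 : ℝ) 1 ∧ ∃ w : ℍ, steepestDeriv μ p (w : ℂ) = 0}

/-- `χ_L(w) = w + C(w̄) (w - w̄) / (C(w) - C(w̄))`. -/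
noncomputable def chiLiquid (μ : Measure ℝ) (w : ℂ) : ℂ :=
  w + cauchyTransform μ (starRingEnd ℂ w) * (w - starRingEnd ℂ w) /
    (cauchyTransform μ w - cauchyTransform μ (starRingEnd ℂ w))

/-- `η_L(w) = 1 + C(w) C(w̄) (w - w̄) / (C(w) - C(w̄))`. -/
noncomputable def etaLiquid (μ : Measure ℝ) (w : ℂ) : ℂ :=
  1 + cauchyTransform μ w * cauchyTransform μ (starRingEnd ℂ w) * (w - starRingEnd ℂ w) /
    (cauchyTransform μ w - cauchyTransform μ (starRingEnd ℂ w))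

/-! Put S(w) = ∫ |w - x|⁻² μ(dx), so that Im C(w) = -Im w · S(w). For fixed w the root equation
C(w)(w - χ) = 1 - η is a real linear system in (χ, η) with one solution, `liquidPoint μ w`; hence
the liquid region is the image of ℍ under `liquidPoint`. The rest is strict Cauchy–Schwarz,
available because the support contains two points. Applied to 1 and 1/(w - x), it gives 0 < η = 1 -
|C|²/S < 1; χ is a weighted mean of x, so it lies in (a, b). If w ≠ z are roots for the same point,
subtracting their equations gives (1 - η) ∫ 1/((w - x)(z - x)) μ(dx) = C(w) C(z). Since 1 - η =
|C|²/S at both roots, taking norms turns this into an equality in Cauchy–Schwarz, which is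
impossible. A double root gives the same identity with z = w. Continuity is direct, and openness of
`liquidPoint` is stability of a simple isolated root under perturbation of (χ, η). -/

open Filter Topology ComplexConjugate

/-! ### Equality in Cauchy–Schwarz, on the support -/

theorem eqOn_support_of_ae_eq {E : Type*} [TopologicalSpace E] [T2Space E] {μ : Measure ℝ}
    {f g : ℝ → E} (hf : Continuous f) (hg : Continuous g) (h : f =ᵐ[μ] g) :
    EqOn f g μ.support :=
  Measure.support_subset_of_isClosed (isClosed_eq hf hg) h

/-- The equality case of the Cauchy–Schwarz inequality, for bounded continuous functions. -/
theorem exists_eq_mul_conj_of_integral_mul_le {μ : Measure ℝ} [IsProbabilityMeasure μ]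
    {f g : ℝ → ℂ} (hf : Continuous f) (hg : Continuous g) {M N : ℝ}
    (hM : ∀ x, ‖f x‖ ≤ M) (hN : ∀ x, ‖g x‖ ≤ N)
    (hpos : 0 < ∫ x, ‖g x‖ ^ 2 ∂μ)
    (h : (∫ x, ‖f x‖ ^ 2 ∂μ) * (∫ x, ‖g x‖ ^ 2 ∂μ) ≤ ‖∫ x, f x * g x ∂μ‖ ^ 2) :
    ∃ c : ℂ, ∀ x ∈ μ.support, f x = c * conj (g x) := by
  set A := ∫ x, ‖f x‖ ^ 2 ∂μ
  set B := ∫ x, ‖g x‖ ^ 2 ∂μ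
  set Q := ∫ x, f x * g x ∂μ with hQ
  -- The coefficient of the L² projection of `f` onto `conj g`; the squared residual is then `A -
  -- ‖c‖ ^ 2 * B`.
  set c : ℂ := Q / B with hc
  refine ⟨c, ?_⟩
  have hfi : Integrable (fun x => ‖f x‖ ^ 2) μ := by
    refine Integrable.of_bound (by fun_prop) (M ^ 2) (.of_forall fun x => ?_)
    rw [Real.norm_of_nonneg (by positivity)]
    exact pow_le_pow_left₀ (norm_nonneg _) (hM x) 2
  have hgi : Integrable (fun x => ‖g x‖ ^ 2) μ := by
    refine Integrable.of_bound (by fun_prop) (N ^ 2) (.of_forall fun x => ?_)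
    rw [Real.norm_of_nonneg (by positivity)]
    exact pow_le_pow_left₀ (norm_nonneg _) (hN x) 2
  have hfgi : Integrable (fun x => f x * g x) μ := by
    refine Integrable.of_bound (by fun_prop) (M * N) (.of_forall fun x => ?_)
    rw [norm_mul]
    exact mul_le_mul (hM x) (hN x) (norm_nonneg _) ((norm_nonneg _).trans (hM x))
  have hexp : ∀ x, ‖f x - c * conj (g x)‖ ^ 2 =
      ‖f x‖ ^ 2 + ‖c‖ ^ 2 * ‖g x‖ ^ 2 - 2 * (conj c * (f x * g x)).re := by
    intro x
    simp only [← Complex.normSq_eq_norm_sq, Complex.normSq_apply, Complex.sub_re, Complex.sub_im,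
      Complex.mul_re, Complex.mul_im, Complex.conj_re, Complex.conj_im]
    ring
  have hre : Integrable (fun x => (conj c * (f x * g x)).re) μ := (hfgi.const_mul _).re
  have hint : ∫ x, ‖f x - c * conj (g x)‖ ^ 2 ∂μ = A + ‖c‖ ^ 2 * B - 2 * (conj c * Q).re := by
    simp_rw [hexp]
    rw [integral_sub (f := fun x => ‖f x‖ ^ 2 + ‖c‖ ^ 2 * ‖g x‖ ^ 2)
        (hfi.add (hgi.const_mul _)) (hre.const_mul _),
      integral_add hfi (hgi.const_mul _), integral_const_mul, integral_const_mul]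
    congr 2
    rw [hQ, ← integral_const_mul]
    exact integral_re (hfgi.const_mul (conj c))
  have hcB : Q = c * B := by
    rw [hc, div_mul_cancel₀ _ (by exact_mod_cast hpos.ne')]
  have hval : A + ‖c‖ ^ 2 * B - 2 * (conj c * Q).re = A - ‖c‖ ^ 2 * B := by
    rw [hcB, ← mul_assoc, ← Complex.normSq_eq_conj_mul_self, Complex.normSq_eq_norm_sq,
      ← Complex.ofReal_mul, Complex.ofReal_re]
    ring
  have hle : A - ‖c‖ ^ 2 * B ≤ 0 := by
    rw [hcB, norm_mul, Complex.norm_of_nonneg hpos.le, mul_pow] at h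
    have : A * B ≤ (‖c‖ ^ 2 * B) * B := by linarith
    linarith [le_of_mul_le_mul_right this hpos]
  have hzero : ∫ x, ‖f x - c * conj (g x)‖ ^ 2 ∂μ = 0 :=
    le_antisymm (by rw [hint, hval]; exact hle) (integral_nonneg fun x => by positivity)
  have hi : Integrable (fun x => ‖f x - c * conj (g x)‖ ^ 2) μ := by
    simp_rw [hexp]
    exact (hfi.add (hgi.const_mul _)).sub (hre.const_mul _)
  have hae := (integral_eq_zero_iff_of_nonneg (fun x => by positivity) hi).1 hzero
  have hcont : Continuous fun x => ‖f x - c * conj (g x)‖ ^ 2 := by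
    have := Complex.continuous_conj.comp hg
    exact ((hf.sub (continuous_const.mul this)).norm).pow 2
  intro x hx
  have := eqOn_support_of_ae_eq hcont continuous_const hae hx
  exact sub_eq_zero.1 (norm_eq_zero.1 (pow_eq_zero_iff two_ne_zero |>.1 this))

/-! ### The kernel 1/(w - x) -/

section Kernel

variable {w : ℂ}

theorem sub_ofReal_ne_zero_of_im_ne_zero (hw : w.im ≠ 0) (x : ℝ) : w - x ≠ 0 := by
  intro h
  apply hw
  simpa using congrArg Complex.im h

theorem continuous_one_div_sub_ofReal (hw : w.im ≠ 0) :
    Continuous fun x : ℝ => 1 / (w - (x : ℂ)) :=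
  continuous_const.div (by fun_prop) (sub_ofReal_ne_zero_of_im_ne_zero hw)

theorem norm_one_div_sub_ofReal_le (hw : w.im ≠ 0) (x : ℝ) :
    ‖1 / (w - (x : ℂ))‖ ≤ 1 / |w.im| := by
  rw [norm_div, norm_one]
  refine one_div_le_one_div_of_le (abs_pos.2 hw) ?_
  simpa using Complex.abs_im_le_norm (w - (x : ℂ))

theorem integrable_one_div_sub_ofReal (μ : Measure ℝ) [IsFiniteMeasure μ] (hw : w.im ≠ 0) :
    Integrable (fun x : ℝ => 1 / (w - (x : ℂ))) μ :=
  Integrable.of_bound (continuous_one_div_sub_ofReal hw).aestronglyMeasurable _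
    (.of_forall (norm_one_div_sub_ofReal_le hw))

theorem integrable_norm_sq_one_div_sub_ofReal (μ : Measure ℝ) [IsFiniteMeasure μ]
    (hw : w.im ≠ 0) : Integrable (fun x : ℝ => ‖1 / (w - (x : ℂ))‖ ^ 2) μ := by
  refine Integrable.of_bound ((continuous_one_div_sub_ofReal hw).norm.pow 2).aestronglyMeasurable
    ((1 / |w.im|) ^ 2) (.of_forall fun x => ?_)
  rw [Real.norm_of_nonneg (by positivity)]
  exact pow_le_pow_left₀ (norm_nonneg _) (norm_one_div_sub_ofReal_le hw x) 2

theorem re_one_div_sub_ofReal (x : ℝ) :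
    (1 / (w - (x : ℂ))).re = (w.re - x) * ‖1 / (w - (x : ℂ))‖ ^ 2 := by
  rw [← Complex.normSq_eq_norm_sq, one_div, Complex.inv_re, Complex.normSq_inv]
  simp [div_eq_mul_inv]

theorem im_one_div_sub_ofReal (x : ℝ) :
    (1 / (w - (x : ℂ))).im = -w.im * ‖1 / (w - (x : ℂ))‖ ^ 2 := by
  rw [← Complex.normSq_eq_norm_sq, one_div, Complex.inv_im, Complex.normSq_inv]
  simp [div_eq_mul_inv]

end Kernel

/-- The total mass `∫ |w - x|⁻² μ(dx)` of the Poisson-type kernel at `w`. -/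
noncomputable def sqKernelMass (μ : Measure ℝ) (w : ℂ) : ℝ :=
  ∫ x : ℝ, ‖1 / (w - (x : ℂ))‖ ^ 2 ∂μ

/-! ### The Cauchy transform and strict Cauchy–Schwarz bounds -/

section Cauchy

variable {μ : Measure ℝ} [IsProbabilityMeasure μ] {w : ℂ}

theorem sqKernelMass_pos (hw : w.im ≠ 0) : 0 < sqKernelMass μ w := by
  refine (integral_pos_iff_support_of_nonneg (fun x => by positivity)
    (integrable_norm_sq_one_div_sub_ofReal μ hw)).2 ?_
  have : Function.support (fun x : ℝ => ‖1 / (w - (x : ℂ))‖ ^ 2) = univ := by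
    ext x
    simpa using sub_ofReal_ne_zero_of_im_ne_zero hw x
  rw [this, measure_univ]
  exact one_pos

theorem im_cauchyTransform (hw : w.im ≠ 0) :
    (cauchyTransform μ w).im = -w.im * sqKernelMass μ w := by
  rw [sqKernelMass, ← integral_const_mul, cauchyTransform]
  refine (integral_im (integrable_one_div_sub_ofReal μ hw)).symm.trans ?_
  exact integral_congr_ae (.of_forall fun x => im_one_div_sub_ofReal x)

omit [IsProbabilityMeasure μ] in
theorem cauchyTransform_conj (w : ℂ) :
    cauchyTransform μ (conj w) = conj (cauchyTransform μ w) := by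
  rw [cauchyTransform, cauchyTransform, ← integral_conj]
  simp

theorem cauchyTransform_ne_zero (hw : w.im ≠ 0) : cauchyTransform μ w ≠ 0 := by
  intro h
  have := im_cauchyTransform (μ := μ) hw
  rw [h] at this
  simp [hw, (sqKernelMass_pos (μ := μ) hw).ne'] at this

theorem norm_sq_cauchyTransform_lt {a b : ℝ} (hab : a ≠ b) (ha : a ∈ μ.support)
    (hb : b ∈ μ.support) (hw : w.im ≠ 0) :
    ‖cauchyTransform μ w‖ ^ 2 < sqKernelMass μ w := by
  by_contra! h
  obtain ⟨c, hc⟩ := exists_eq_mul_conj_of_integral_mul_le (μ := μ) (f := fun _ => 1)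
    (g := fun x : ℝ => 1 / (w - (x : ℂ))) continuous_const (continuous_one_div_sub_ofReal hw)
    (M := 1) (fun x => by simp) (norm_one_div_sub_ofReal_le hw) (sqKernelMass_pos hw)
    (by simpa [sqKernelMass, cauchyTransform] using h)
  have hconj : ∀ x ∈ μ.support, conj w - (x : ℂ) = c := by
    intro x hx
    have h1 := hc x hx
    have h2 : conj w - (x : ℂ) ≠ 0 := sub_ofReal_ne_zero_of_im_ne_zero (by simpa using hw) x
    simp only [map_div₀, map_one, map_sub, Complex.conj_ofReal] at h1
    field_simp at h1
    exact h1
  have := (hconj a ha).trans (hconj b hb).symm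
  simp [hab] at this

theorem norm_sq_integral_mul_lt {a b : ℝ} (hab : a ≠ b) (ha : a ∈ μ.support)
    (hb : b ∈ μ.support) {z : ℂ} (hw : 0 < w.im) (hz : 0 < z.im) :
    ‖∫ x : ℝ, 1 / (w - (x : ℂ)) * (1 / (z - (x : ℂ))) ∂μ‖ ^ 2 <
      sqKernelMass μ w * sqKernelMass μ z := by
  by_contra! h
  obtain ⟨c, hc⟩ := exists_eq_mul_conj_of_integral_mul_le (μ := μ)
    (continuous_one_div_sub_ofReal hw.ne') (continuous_one_div_sub_ofReal hz.ne')
    (norm_one_div_sub_ofReal_le hw.ne') (norm_one_div_sub_ofReal_le hz.ne')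
    (sqKernelMass_pos hz.ne') h
  have hconj : ∀ x ∈ μ.support, conj z - (x : ℂ) = c * (w - x) := by
    intro x hx
    have h1 := hc x hx
    have h2 : conj z - (x : ℂ) ≠ 0 := sub_ofReal_ne_zero_of_im_ne_zero (by simpa using hz.ne') x
    have h3 := sub_ofReal_ne_zero_of_im_ne_zero hw.ne' x
    simp only [map_div₀, map_one, map_sub, Complex.conj_ofReal] at h1
    field_simp at h1
    rw [h1, mul_comm]
  have h1 := hconj a ha
  have h2 := hconj b hb
  have hba : (b : ℂ) - a ≠ 0 := by
    rw [sub_ne_zero]; exact_mod_cast hab.symm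
  -- Proportionality at the two points a and b forces slope 1, so `conj z = w`, impossible in ℍ.
  have hc1 : c = 1 := by
    apply mul_right_cancel₀ hba
    linear_combination h2 - h1
  rw [hc1, one_mul] at h1
  have := congrArg Complex.im h1
  simp at this
  linarith

/-- The resolvent identity, integrated; it yields both the derivative of C and the uniqueness of
roots. -/
theorem cauchyTransform_sub {z : ℂ} (hw : w.im ≠ 0) (hz : z.im ≠ 0) :
    cauchyTransform μ w - cauchyTransform μ z =
      -(w - z) * ∫ x : ℝ, 1 / (w - (x : ℂ)) * (1 / (z - (x : ℂ))) ∂μ := by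
  rw [cauchyTransform, cauchyTransform, ← integral_sub (integrable_one_div_sub_ofReal μ hw)
    (integrable_one_div_sub_ofReal μ hz), ← integral_const_mul]
  congr 1 with x
  have h2 := sub_ofReal_ne_zero_of_im_ne_zero hw x
  have h3 := sub_ofReal_ne_zero_of_im_ne_zero hz x
  field_simp
  ring

theorem hasDerivAt_cauchyTransform (hw : w.im ≠ 0) :
    HasDerivAt (cauchyTransform μ)
      (-∫ x : ℝ, 1 / (w - (x : ℂ)) * (1 / (w - (x : ℂ))) ∂μ) w := by
  have hopen : ∀ᶠ z in 𝓝 w, |w.im| / 2 < |z.im| :=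
    (continuous_abs.comp Complex.continuous_im).continuousAt.eventually_const_lt
      (half_lt_self (abs_pos.2 hw))
  have hpos : 0 < |w.im| / 2 := half_pos (abs_pos.2 hw)
  rw [hasDerivAt_iff_tendsto_slope]
  have hlim : Tendsto (fun z : ℂ => -∫ x : ℝ, 1 / (z - (x : ℂ)) * (1 / (w - (x : ℂ))) ∂μ) (𝓝 w)
      (𝓝 (-∫ x : ℝ, 1 / (w - (x : ℂ)) * (1 / (w - (x : ℂ))) ∂μ)) := by
    refine (tendsto_integral_filter_of_dominated_convergence
      (fun _ => 1 / (|w.im| / 2) * (1 / |w.im|)) ?_ ?_ (integrable_const _) ?_).neg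
    · filter_upwards [hopen] with z hz
      exact ((continuous_one_div_sub_ofReal (abs_pos.1 (hpos.trans hz))).mul
        (continuous_one_div_sub_ofReal hw)).aestronglyMeasurable
    · filter_upwards [hopen] with z hz
      refine .of_forall fun x => ?_
      rw [norm_mul]
      refine mul_le_mul ?_ (norm_one_div_sub_ofReal_le hw x) (norm_nonneg _) (by positivity)
      exact (norm_one_div_sub_ofReal_le (abs_pos.1 (hpos.trans hz)) x).trans
        (one_div_le_one_div_of_le hpos hz.le)
    · refine .of_forall fun x => ?_
      have h2 := sub_ofReal_ne_zero_of_im_ne_zero hw x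
      have : ContinuousAt (fun z : ℂ => 1 / (z - (x : ℂ)) * (1 / (w - (x : ℂ)))) w := by
        fun_prop (disch := exact h2)
      exact this
  refine (hlim.mono_left nhdsWithin_le_nhds).congr' ?_
  filter_upwards [nhdsWithin_le_nhds hopen, self_mem_nhdsWithin] with z hz hne
  have hzw : z - w ≠ 0 := sub_ne_zero.2 hne
  rw [slope_def_field, cauchyTransform_sub (abs_pos.1 (hpos.trans hz)) hw]
  field_simp

end Cauchy

/-! ### The root equation, solved for (χ, η) -/

section Liquid

variable {μ : Measure ℝ} [IsProbabilityMeasure μ] {a b : ℝ} {w : ℂ} {p : ℝ × ℝ}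

theorem steepestDeriv_eq (hsupp : μ.support ⊆ Icc a b) (p : ℝ × ℝ) (hw : w.im ≠ 0) :
    steepestDeriv μ p w = cauchyTransform μ w - (1 - (p.2 : ℂ)) / (w - (p.1 : ℂ)) :=
  (hasDerivAt_steepestFun μ a b hsupp p w hw).deriv

theorem steepestDeriv_eq_zero_iff_mul (hsupp : μ.support ⊆ Icc a b) (hw : w.im ≠ 0) :
    steepestDeriv μ p w = 0 ↔ cauchyTransform μ w * (w - p.1) = 1 - p.2 := by
  rw [steepestDeriv_eq hsupp p hw, sub_eq_zero,
    eq_div_iff (sub_ofReal_ne_zero_of_im_ne_zero hw p.1)]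

/-- The point `(χ, η)` of the liquid region at which `w` is a root of the steepest descent
derivative. -/
noncomputable def liquidPoint (μ : Measure ℝ) (w : ℂ) : ℝ × ℝ :=
  (w.re - (cauchyTransform μ w).re / sqKernelMass μ w,
    1 - ‖cauchyTransform μ w‖ ^ 2 / sqKernelMass μ w)

/-- The imaginary part of the root equation determines χ because Im C = -Im w · S ≠ 0; the real part
then gives η. -/
theorem steepestDeriv_eq_zero_iff (hsupp : μ.support ⊆ Icc a b) (hw : w.im ≠ 0) :
    steepestDeriv μ p w = 0 ↔ p = liquidPoint μ w := by
  have hS := (sqKernelMass_pos (μ := μ) hw).ne'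
  rw [steepestDeriv_eq_zero_iff_mul hsupp hw, Complex.ext_iff, Prod.ext_iff, liquidPoint,
    ← Complex.normSq_eq_norm_sq, Complex.normSq_apply, im_cauchyTransform hw]
  simp only [Complex.mul_re, Complex.mul_im, Complex.sub_re, Complex.sub_im, Complex.ofReal_re,
    Complex.ofReal_im, im_cauchyTransform hw, Complex.one_re, Complex.one_im, sub_zero]
  generalize (cauchyTransform μ w).re = r
  generalize sqKernelMass μ w = S at hS ⊢
  constructor
  · rintro ⟨h1, h2⟩
    have h3 : p.1 = w.re - r / S := by
      field_simp
      apply mul_left_cancel₀ hw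
      linear_combination h2
    refine ⟨h3, ?_⟩
    rw [h3] at h1
    field_simp at h1 ⊢
    linear_combination h1
  · rintro ⟨h1, h2⟩
    rw [h1, h2]
    constructor <;> field_simp <;> ring

/-- This exhibits χ as the mean of x with weight |w - x|⁻², which places it strictly between a and
b. -/
theorem sqKernelMass_mul_sub_re (hw : w.im ≠ 0) (c : ℝ) :
    sqKernelMass μ w * ((liquidPoint μ w).1 - c) =
      ∫ x : ℝ, (x - c) * ‖1 / (w - (x : ℂ))‖ ^ 2 ∂μ := by
  have hS := (sqKernelMass_pos (μ := μ) hw).ne'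
  have hk := integrable_norm_sq_one_div_sub_ofReal μ hw
  have hC : (cauchyTransform μ w).re = ∫ x : ℝ, (1 / (w - (x : ℂ))).re ∂μ :=
    (integral_re (integrable_one_div_sub_ofReal μ hw)).symm
  have h1 : sqKernelMass μ w * ((liquidPoint μ w).1 - c) =
      (w.re - c) * sqKernelMass μ w - (cauchyTransform μ w).re := by
    simp only [liquidPoint]
    field_simp
    ring
  have hre : Integrable (fun x : ℝ => (1 / (w - (x : ℂ))).re) μ :=
    (integrable_one_div_sub_ofReal μ hw).re
  rw [h1, hC, sqKernelMass, ← integral_const_mul, ← integral_sub (hk.const_mul _) hre]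
  refine integral_congr_ae (.of_forall fun x => ?_)
  simp only [re_one_div_sub_ofReal]
  ring

theorem integrable_sub_mul_sqKernel (hw : w.im ≠ 0) (c : ℝ) :
    Integrable (fun x : ℝ => (x - c) * ‖1 / (w - (x : ℂ))‖ ^ 2) μ := by
  have := ((integrable_norm_sq_one_div_sub_ofReal μ hw).const_mul (w.re - c)).sub
    (integrable_one_div_sub_ofReal μ hw).re
  refine this.congr (.of_forall fun x => ?_)
  simp only [Pi.sub_apply, RCLike.re_to_complex, re_one_div_sub_ofReal]
  ring

omit [IsProbabilityMeasure μ] in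
theorem integral_mul_sqKernel_pos {f : ℝ → ℝ} (hw : w.im ≠ 0) (hf : Continuous f)
    (hfi : Integrable (fun x : ℝ => f x * ‖1 / (w - (x : ℂ))‖ ^ 2) μ)
    (hnonneg : ∀ x ∈ μ.support, 0 ≤ f x) {c : ℝ} (hc : c ∈ μ.support) (hfc : f c ≠ 0) :
    0 < ∫ x : ℝ, f x * ‖1 / (w - (x : ℂ))‖ ^ 2 ∂μ := by
  have h0 : 0 ≤ᵐ[μ] fun x : ℝ => f x * ‖1 / (w - (x : ℂ))‖ ^ 2 := by
    filter_upwards [μ.support_mem_ae] with x hx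
    exact mul_nonneg (hnonneg x hx) (by positivity)
  refine (integral_nonneg_of_ae h0).lt_of_ne' fun h => ?_
  have hae := (integral_eq_zero_iff_of_nonneg_ae h0 hfi).1 h
  have := eqOn_support_of_ae_eq (hf.mul ((continuous_one_div_sub_ofReal hw).norm.pow 2))
    continuous_const hae hc
  rcases mul_eq_zero.1 this with h | h
  · exact hfc h
  · exact one_div_ne_zero (sub_ofReal_ne_zero_of_im_ne_zero hw c)
      (norm_eq_zero.1 (pow_eq_zero_iff two_ne_zero |>.1 h))

theorem liquidPoint_mem (hab : a < b) (hsupp : μ.support ⊆ Icc a b) (ha : a ∈ μ.support)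
    (hb : b ∈ μ.support) (hw : w.im ≠ 0) :
    liquidPoint μ w ∈ Ioo a b ×ˢ Ioo (0 : ℝ) 1 := by
  have hS := sqKernelMass_pos (μ := μ) hw
  refine ⟨⟨?_, ?_⟩, ?_, ?_⟩
  · have h := integral_mul_sqKernel_pos (μ := μ) hw (by fun_prop : Continuous fun x : ℝ => x - a)
      (integrable_sub_mul_sqKernel hw a) (fun x hx => sub_nonneg.2 (hsupp hx).1) hb
      (sub_ne_zero.2 hab.ne')
    rw [← sqKernelMass_mul_sub_re hw] at h
    exact sub_pos.1 (pos_of_mul_pos_right h hS.le)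
  · have hi := (integrable_sub_mul_sqKernel (μ := μ) hw b).neg
    have h := integral_mul_sqKernel_pos (μ := μ) hw
      (by fun_prop : Continuous fun x : ℝ => -(x - b))
      (hi.congr (.of_forall fun x => (neg_mul _ _).symm))
      (fun x hx => neg_nonneg.2 (sub_nonpos.2 (hsupp hx).2)) ha
      (neg_ne_zero.2 (sub_ne_zero.2 hab.ne))
    simp_rw [neg_mul] at h
    rw [integral_neg, ← sqKernelMass_mul_sub_re hw, ← mul_neg] at h
    linarith [pos_of_mul_pos_right h hS.le]
  · exact sub_pos.2 ((div_lt_one hS).2 (norm_sq_cauchyTransform_lt hab.ne ha hb hw))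
  · refine sub_lt_self _ (div_pos (pow_pos (norm_pos_iff.2 (cauchyTransform_ne_zero hw)) 2) hS)

/-- If `z` and `w` are roots for the same point, the Cauchy–Schwarz inequality for the product
kernel would be an equality. -/
theorem integral_mul_ne_of_liquidPoint_eq {z : ℂ} (hab : a ≠ b) (ha : a ∈ μ.support)
    (hb : b ∈ μ.support) (hw : 0 < w.im) (hz : 0 < z.im)
    (h : (liquidPoint μ w).2 = (liquidPoint μ z).2) :
    (1 - ((liquidPoint μ w).2 : ℂ)) * ∫ x : ℝ, 1 / (w - (x : ℂ)) * (1 / (z - (x : ℂ))) ∂μ ≠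
      cauchyTransform μ w * cauchyTransform μ z := by
  intro heq
  have hlt := norm_sq_integral_mul_lt hab ha hb hw hz
  have hSw := sqKernelMass_pos (μ := μ) hw.ne'
  have hSz := sqKernelMass_pos (μ := μ) hz.ne'
  have hCw := norm_pos_iff.2 (cauchyTransform_ne_zero (μ := μ) hw.ne')
  have h1 := congrArg (fun t : ℂ => ‖t‖ ^ 2) heq
  have hnorm : ‖1 - ((liquidPoint μ w).2 : ℂ)‖ ^ 2 =
      (1 - (liquidPoint μ w).2) * (1 - (liquidPoint μ z).2) := by
    rw [← h, ← Complex.ofReal_one, ← Complex.ofReal_sub, Complex.norm_real, Real.norm_eq_abs,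
      sq_abs, sq]
  simp only [norm_mul, mul_pow, hnorm] at h1
  simp only [liquidPoint, sub_sub_cancel] at h h1
  have hpos : 0 < ‖cauchyTransform μ w‖ ^ 2 / sqKernelMass μ w := div_pos (pow_pos hCw 2) hSw
  have hpos' : 0 < ‖cauchyTransform μ z‖ ^ 2 / sqKernelMass μ z := by
    have h' : ‖cauchyTransform μ w‖ ^ 2 / sqKernelMass μ w =
      ‖cauchyTransform μ z‖ ^ 2 / sqKernelMass μ z := by linarith
    rwa [← h']
  have h2 := mul_lt_mul_of_pos_left hlt (mul_pos hpos hpos')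
  rw [h1] at h2
  refine h2.ne ?_
  field_simp

theorem liquidPoint_injOn (hab : a ≠ b) (hsupp : μ.support ⊆ Icc a b) (ha : a ∈ μ.support)
    (hb : b ∈ μ.support) : InjOn (liquidPoint μ) {w : ℂ | 0 < w.im} := by
  intro w hw z hz h
  by_contra hne
  have hw' : w.im ≠ 0 := (show 0 < w.im from hw).ne'
  have hz' : z.im ≠ 0 := (show 0 < z.im from hz).ne'
  refine integral_mul_ne_of_liquidPoint_eq hab ha hb hw hz (congrArg Prod.snd h) ?_
  have h1 := (steepestDeriv_eq_zero_iff_mul hsupp hw').1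
    ((steepestDeriv_eq_zero_iff (μ := μ) hsupp hw').2 rfl)
  have h2 := (steepestDeriv_eq_zero_iff_mul hsupp hz').1
    ((steepestDeriv_eq_zero_iff (μ := μ) hsupp hz').2 h)
  have h3 := cauchyTransform_sub (μ := μ) hw' hz'
  apply mul_left_cancel₀ (sub_ne_zero.2 hne)
  linear_combination (cauchyTransform μ w) * h2 - (cauchyTransform μ z) * h1 +
    (1 - ((liquidPoint μ w).2 : ℂ)) * h3

theorem hasDerivAt_steepestDeriv (hsupp : μ.support ⊆ Icc a b) (p : ℝ × ℝ) (hw : w.im ≠ 0) :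
    HasDerivAt (steepestDeriv μ p) ((1 - (p.2 : ℂ)) / (w - (p.1 : ℂ)) ^ 2 -
      ∫ x : ℝ, 1 / (w - (x : ℂ)) * (1 / (w - (x : ℂ))) ∂μ) w := by
  have h1 := ((hasDerivAt_id w).sub_const (p.1 : ℂ)).inv (sub_ofReal_ne_zero_of_im_ne_zero hw p.1)
  have h2 := (hasDerivAt_cauchyTransform (μ := μ) hw).sub (h1.const_mul (1 - (p.2 : ℂ)))
  refine (h2.congr_deriv (by simp only [id]; ring)).congr_of_eventuallyEq ?_
  filter_upwards [Complex.continuous_im.continuousAt.eventually_ne hw] with z hz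
  rw [steepestDeriv_eq hsupp p hz, div_eq_mul_inv]
  rfl

theorem isOpen_setOf_im_ne_zero : IsOpen {w : ℂ | w.im ≠ 0} :=
  isOpen_ne_fun Complex.continuous_im continuous_const

theorem analyticAt_steepestDeriv (hsupp : μ.support ⊆ Icc a b) (p : ℝ × ℝ) (hw : w.im ≠ 0) :
    AnalyticAt ℂ (steepestDeriv μ p) w := by
  refine DifferentiableOn.analyticAt (s := {w : ℂ | w.im ≠ 0}) (fun z hz => ?_)
    (isOpen_setOf_im_ne_zero.mem_nhds hw)
  exact (hasDerivAt_steepestDeriv hsupp p hz).differentiableAt.differentiableWithinAt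

/-- At a root, 1 - η = C(w)(w - χ), so a vanishing derivative is the identity excluded above, with z
= w. -/
theorem deriv_steepestDeriv_liquidPoint_ne_zero (hab : a ≠ b) (hsupp : μ.support ⊆ Icc a b)
    (ha : a ∈ μ.support) (hb : b ∈ μ.support) (hw : 0 < w.im) :
    deriv (steepestDeriv μ (liquidPoint μ w)) w ≠ 0 := by
  rw [(hasDerivAt_steepestDeriv hsupp _ hw.ne').deriv]
  intro h
  refine integral_mul_ne_of_liquidPoint_eq hab ha hb hw hw rfl ?_
  have h1 := (steepestDeriv_eq_zero_iff_mul hsupp hw.ne').1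
    ((steepestDeriv_eq_zero_iff (μ := μ) hsupp hw.ne').2 rfl)
  have h2 := sub_ofReal_ne_zero_of_im_ne_zero hw.ne' (liquidPoint μ w).1
  rw [← sub_eq_zero.1 h, ← h1]
  field_simp

theorem chiLiquid_eq (hw : w.im ≠ 0) : chiLiquid μ w = ((liquidPoint μ w).1 : ℂ) := by
  have hS : (sqKernelMass μ w : ℂ) ≠ 0 := by exact_mod_cast (sqKernelMass_pos hw).ne'
  have hv : (w.im : ℂ) ≠ 0 := by exact_mod_cast hw
  rw [chiLiquid, cauchyTransform_conj, Complex.sub_conj, Complex.sub_conj, im_cauchyTransform hw]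
  simp only [liquidPoint]
  have h1 : conj (cauchyTransform μ w) =
      (cauchyTransform μ w).re + w.im * sqKernelMass μ w * Complex.I := by
    apply Complex.ext <;> simp [im_cauchyTransform hw]
  rw [h1]
  push_cast
  nth_rewrite 1 [← Complex.re_add_im w]
  field_simp
  ring

theorem etaLiquid_eq (hw : w.im ≠ 0) : etaLiquid μ w = ((liquidPoint μ w).2 : ℂ) := by
  have hS : (sqKernelMass μ w : ℂ) ≠ 0 := by exact_mod_cast (sqKernelMass_pos hw).ne'
  have hv : (w.im : ℂ) ≠ 0 := by exact_mod_cast hw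
  rw [etaLiquid, cauchyTransform_conj, Complex.sub_conj, Complex.sub_conj, im_cauchyTransform hw,
    Complex.mul_conj, Complex.normSq_eq_norm_sq]
  simp only [liquidPoint]
  push_cast
  field_simp
  ring

/-! ### Continuity and openness -/

theorem continuousAt_liquidPoint (hw : w.im ≠ 0) : ContinuousAt (liquidPoint μ) w := by
  have hC : ContinuousAt (cauchyTransform μ) w := (hasDerivAt_cauchyTransform hw).continuousAt
  have hS : ContinuousAt (sqKernelMass μ) w := by
    -- S = -Im C / Im w inherits continuity from C.
    have h1 : ContinuousAt (fun z => -((cauchyTransform μ z).im / z.im)) w :=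
      ((Complex.continuous_im.continuousAt.comp hC).div Complex.continuous_im.continuousAt hw).neg
    refine h1.congr ?_
    filter_upwards [Complex.continuous_im.continuousAt.eventually_ne hw] with z hz
    rw [im_cauchyTransform hz]
    field_simp
  have hne := (sqKernelMass_pos (μ := μ) hw).ne'
  refine ContinuousAt.prodMk ?_ ?_
  · exact Complex.continuous_re.continuousAt.sub
      ((Complex.continuous_re.continuousAt.comp hC).div hS hne)
  · exact continuousAt_const.sub ((hC.norm.pow 2).div hS hne)

/-- Roots of the steepest descent derivative persist under small changes of the parameter. -/
theorem eventually_exists_root_near (hab : a ≠ b) (hsupp : μ.support ⊆ Icc a b)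
    (ha : a ∈ μ.support) (hb : b ∈ μ.support) (hw : 0 < w.im) {r : ℝ} (hr : 0 < r)
    (hball : ∀ z ∈ Metric.closedBall w r, 0 < z.im) :
    ∀ᶠ p in 𝓝 (liquidPoint μ w), ∃ z ∈ Metric.closedBall w r, steepestDeriv μ p z = 0 := by
  set p₀ := liquidPoint μ w
  set K := Metric.sphere w r
  have hKim : ∀ z ∈ K, 0 < z.im := fun z hz => hball z (Metric.sphere_subset_closedBall hz)
  have hw0 : steepestDeriv μ p₀ w = 0 := (steepestDeriv_eq_zero_iff hsupp hw.ne').2 rfl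
  have hcont : ∀ z : ℂ, 0 < z.im →
      ContinuousAt (fun q : (ℝ × ℝ) × ℂ => steepestDeriv μ q.1 q.2) (p₀, z) := by
    intro z hz
    have hC : ContinuousAt (fun q : (ℝ × ℝ) × ℂ => cauchyTransform μ q.2) (p₀, z) :=
      ContinuousAt.comp (f := Prod.snd) (g := cauchyTransform μ)
        (hasDerivAt_cauchyTransform hz.ne').continuousAt continuousAt_snd
    have hd : ContinuousAt (fun q : (ℝ × ℝ) × ℂ => cauchyTransform μ q.2 -
        (1 - (q.1.2 : ℂ)) / (q.2 - (q.1.1 : ℂ))) (p₀, z) := by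
      refine hC.sub (ContinuousAt.div (by fun_prop) (by fun_prop) ?_)
      exact sub_ofReal_ne_zero_of_im_ne_zero hz.ne' _
    refine hd.congr ?_
    have him : ContinuousAt (fun q : (ℝ × ℝ) × ℂ => q.2.im) (p₀, z) := by fun_prop
    filter_upwards [him.eventually_ne hz.ne'] with q hq
    exact (steepestDeriv_eq hsupp q.1 hq).symm
  have hne : ∀ z ∈ K, steepestDeriv μ p₀ z ≠ 0 := by
    intro z hz h0
    have h1 := (steepestDeriv_eq_zero_iff hsupp (hKim z hz).ne').1 h0
    have h2 := liquidPoint_injOn hab hsupp ha hb hw (hKim z hz) h1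
    have h3 : dist z w = r := hz
    rw [h2, dist_self] at h3
    exact hr.ne h3
  obtain ⟨m, hm, hmK⟩ : ∃ m > 0, ∀ z ∈ K, m < ‖steepestDeriv μ p₀ z‖ := by
    have hcK : ContinuousOn (fun z => ‖steepestDeriv μ p₀ z‖) K := fun z hz =>
      (hasDerivAt_steepestDeriv hsupp p₀ (hKim z hz).ne').continuousAt.norm.continuousWithinAt
    obtain ⟨z₀, hz₀, hmin⟩ := (isCompact_sphere w r).exists_isMinOn
      (NormedSpace.sphere_nonempty.2 hr.le) hcK
    have hpos : 0 < ‖steepestDeriv μ p₀ z₀‖ := norm_pos_iff.2 (hne z₀ hz₀)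
    exact ⟨_, half_pos hpos, fun z hz => (half_lt_self hpos).trans_le (hmin hz)⟩
  have hev1 : ∀ᶠ p in 𝓝 p₀, ∀ z ∈ K, m < ‖steepestDeriv μ p z‖ := by
    refine (isCompact_sphere w r).eventually_forall_of_forall_eventually fun z hz => ?_
    exact (hcont z (hKim z hz)).norm.eventually_const_lt (hmK z hz)
  have hcw : ContinuousAt (fun p => steepestDeriv μ p w) p₀ :=
    ContinuousAt.comp (f := fun p : ℝ × ℝ => (p, w)) (hcont w hw) (by fun_prop)
  -- With values above m on the sphere and below m/4 at the centre, the oscillation is at least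
  -- 3m/4. The quantitative open mapping theorem then covers a ball of radius 3m/8 > m/4 about the
  -- central value, which contains 0.
  have hev2 : ∀ᶠ p in 𝓝 p₀, ‖steepestDeriv μ p w‖ < m / 4 := by
    refine hcw.norm.eventually_lt_const ?_
    simp only [hw0, norm_zero]
    positivity
  -- Needed only so that the perturbed function is not locally constant at w.
  have hev3 : ∀ᶠ p in 𝓝 p₀, deriv (steepestDeriv μ p) w ≠ 0 := by
    have h1 := deriv_steepestDeriv_liquidPoint_ne_zero hab hsupp ha hb hw
    refine ContinuousAt.eventually_ne (y := 0) ?_ h1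
    simp_rw [fun p => (hasDerivAt_steepestDeriv (μ := μ) hsupp p hw.ne').deriv]
    refine ContinuousAt.sub (ContinuousAt.div (by fun_prop) (by fun_prop) ?_) continuousAt_const
    exact pow_ne_zero 2 (sub_ofReal_ne_zero_of_im_ne_zero hw.ne' _)
  filter_upwards [hev1, hev2, hev3] with p h1 h2 h3
  have hd : DiffContOnCl ℂ (steepestDeriv μ p) (Metric.ball w r) := by
    refine DifferentiableOn.diffContOnCl_ball (U := {z : ℂ | 0 < z.im}) (fun z hz => ?_) hball
    exact (hasDerivAt_steepestDeriv hsupp p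
      (show 0 < z.im from hz).ne').differentiableAt.differentiableWithinAt
  have hfreq : ∃ᶠ z in 𝓝 w, steepestDeriv μ p z ≠ steepestDeriv μ p w := by
    have h4 : DifferentiableAt ℂ (steepestDeriv μ p) w :=
      (hasDerivAt_steepestDeriv hsupp p hw.ne').differentiableAt
    exact ((h4.hasDerivAt.eventually_ne h3).frequently).filter_mono nhdsWithin_le_nhds
  have hsub := hd.ball_subset_image_closedBall hr (ε := m * (3 / 4)) (fun z hz => by
    have h4 := norm_sub_norm_le (steepestDeriv μ p z) (steepestDeriv μ p w)
    have h5 := h1 z hz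
    linarith) hfreq
  have h0 : (0 : ℂ) ∈ Metric.ball (steepestDeriv μ p w) (m * (3 / 4) / 2) := by
    rw [Metric.mem_ball, dist_zero_left]
    linarith
  obtain ⟨z, hz, hz0⟩ := hsub h0
  exact ⟨z, hz, hz0⟩

theorem liquidRegion_eq_range (hab : a < b) (hsupp : μ.support ⊆ Icc a b)
    (ha : a ∈ μ.support) (hb : b ∈ μ.support) :
    liquidRegion μ a b = range fun w : ℍ => liquidPoint μ w := by
  ext p
  constructor
  · rintro ⟨-, w, hw⟩
    exact ⟨w, ((steepestDeriv_eq_zero_iff hsupp w.coe_im_pos.ne').1 hw).symm⟩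
  · rintro ⟨w, rfl⟩
    have h := liquidPoint_mem hab hsupp ha hb w.coe_im_pos.ne'
    exact ⟨⟨Ioo_subset_Icc_self h.1, Ioo_subset_Icc_self h.2⟩, w,
      (steepestDeriv_eq_zero_iff hsupp w.coe_im_pos.ne').2 rfl⟩

/-- A root z near w for the parameter p is a preimage of p near w. -/
theorem isOpenMap_liquidPoint (hab : a ≠ b) (hsupp : μ.support ⊆ Icc a b)
    (ha : a ∈ μ.support) (hb : b ∈ μ.support) :
    IsOpenMap fun w : ℍ => liquidPoint μ w := by
  refine IsOpenMap.of_nhds_le fun w => ?_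
  intro s hs
  rw [mem_map, isEmbedding_coe.nhds_eq_comap] at hs
  obtain ⟨t, ht, hts⟩ := hs
  have him : {z : ℂ | 0 < z.im} ∈ 𝓝 (w : ℂ) :=
    Complex.continuous_im.continuousAt.eventually_const_lt w.coe_im_pos
  obtain ⟨r, hr, hrt⟩ := Metric.nhds_basis_closedBall.mem_iff.1 (inter_mem ht him)
  filter_upwards [eventually_exists_root_near hab hsupp ha hb w.coe_im_pos hr
    (fun z hz => (hrt hz).2)] with p hp
  obtain ⟨z, hz, hz0⟩ := hp
  have hzim : 0 < z.im := (hrt hz).2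
  rw [(steepestDeriv_eq_zero_iff hsupp hzim.ne').1 hz0]
  exact hts (show ((⟨z, hzim⟩ : ℍ) : ℂ) ∈ t from (hrt hz).1)

theorem isOpenEmbedding_liquidPoint (hab : a ≠ b) (hsupp : μ.support ⊆ Icc a b)
    (ha : a ∈ μ.support) (hb : b ∈ μ.support) :
    IsOpenEmbedding fun w : ℍ => liquidPoint μ w := by
  refine .of_continuous_injective_isOpenMap ?_ ?_ (isOpenMap_liquidPoint hab hsupp ha hb)
  · refine continuous_iff_continuousAt.2 fun w => ?_
    exact ContinuousAt.comp (g := liquidPoint μ) (continuousAt_liquidPoint w.coe_im_pos.ne')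
      UpperHalfPlane.continuous_coe.continuousAt
  · intro w z h
    exact UpperHalfPlane.ext (liquidPoint_injOn hab hsupp ha hb w.coe_im_pos z.coe_im_pos h)

end Liquid

/-! ### Conclusion -/

theorem mainTheorem5 (μ : Measure ℝ) [IsProbabilityMeasure μ] (a b : ℝ) (hab : a < b)
    (hsupp : μ.support ⊆ Icc a b) (ha : a ∈ μ.support) (hb : b ∈ μ.support) :
    -- the points of the liquid region lie in the open rectangle
    liquidRegion μ a b ⊆ Ioo a b ×ˢ Ioo (0 : ℝ) 1 ∧
    -- the root in the upper half-plane is unique, and has multiplicity one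
    (∀ p ∈ liquidRegion μ a b, (∃! w : ℍ, steepestDeriv μ p (w : ℂ) = 0) ∧
      ∀ w : ℍ, steepestDeriv μ p (w : ℂ) = 0 →
        analyticOrderAt (steepestDeriv μ p) (w : ℂ) = 1) ∧
    -- the map to that root is a homeomorphism onto the upper half-plane, with explicit inverse
    ∃ W : liquidRegion μ a b ≃ₜ ℍ,
      (∀ p : liquidRegion μ a b, steepestDeriv μ (p : ℝ × ℝ) (W p : ℂ) = 0) ∧
      ∀ w : ℍ, (((W.symm w : ℝ × ℝ).1 : ℝ) : ℂ) = chiLiquid μ (w : ℂ) ∧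
        (((W.symm w : ℝ × ℝ).2 : ℝ) : ℂ) = etaLiquid μ (w : ℂ) := by
  have hL := liquidRegion_eq_range hab hsupp ha hb
  have hemb := isOpenEmbedding_liquidPoint hab.ne hsupp ha hb
  have hiff : ∀ (p : ℝ × ℝ) (w : ℍ), steepestDeriv μ p w = 0 ↔ p = liquidPoint μ w :=
    fun p w => steepestDeriv_eq_zero_iff hsupp w.coe_im_pos.ne'
  refine ⟨?_, ?_, ?_⟩
  · rw [hL]
    rintro _ ⟨w, rfl⟩
    exact liquidPoint_mem hab hsupp ha hb w.coe_im_pos.ne'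
  · intro p hp
    refine ⟨?_, fun w hw => ?_⟩
    · obtain ⟨w, hw⟩ := hp.2
      refine ⟨w, hw, fun z hz => ?_⟩
      exact hemb.injective (((hiff p z).1 hz).symm.trans ((hiff p w).1 hw))
    · refine (analyticAt_steepestDeriv hsupp p w.coe_im_pos.ne').analyticOrderAt_eq_one_of_zero_deriv_ne_zero
        hw ?_
      rw [(hiff p w).1 hw]
      exact deriv_steepestDeriv_liquidPoint_ne_zero hab.ne hsupp ha hb w.coe_im_pos
  · let e : ℍ ≃ₜ liquidRegion μ a b :=
      hemb.toIsEmbedding.toHomeomorph.trans (Homeomorph.setCongr hL.symm)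
    have he : ∀ w : ℍ, (e w : ℝ × ℝ) = liquidPoint μ w := fun w => rfl
    refine ⟨e.symm, fun p => ?_, fun w => ?_⟩
    · rw [hiff, ← he, Homeomorph.apply_symm_apply]
    · rw [Homeomorph.symm_symm, he]
      exact ⟨(chiLiquid_eq w.coe_im_pos.ne').symm, (etaLiquid_eq w.coe_im_pos.ne').symm⟩
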